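/- Let $\Gamma$ be a countably infinite connected (simple) graph with symmetric edge weights $\mu_{x,y}=\mu_{y,x}>0$ for $x\sim y$ (and $\mu_{x,y}=0$ otherwise) such that $\mu(x)=\sum_{y\sim x}\mu_{x,y}<\infty$ for every vertex $x$. Put $\mu(A)=\sum_{y\in A}\mu(y)$, let $d$ be the graph distance, $B(x,R)=\{y: d(x,y)<R\}$ for real $R>0$, $V(x,R)=\mu(B(x,R))$ and $v(x,r,R)=V(x,R)-V(x,r)$. Let $(X_n)$ be the random walk with transition probabilities $P(x,y)=\mu_{x,y}/\mu(x)$, let $T_A=\min\{k: X_k\notin A\}$, $E_z(A)=\mathbb E(T_A\mid X_0=z)$, $E(x,R)=E_x(B(x,R))$ and $\overline E(x,R)=\max_{z\in B(x,R)}E_z(B(x,R))$. Let $\Delta=P-I$, and let $\lambda(x,R)$ be the smallest eigenvalue of $-\Delta$ with Dirichlet boundary conditions on $B(x,R)$, i.e. the smallest $\lambda$ for which there is $f\neq 0$ vanishing outside $B(x,R)$ with $-\Delta f=\lambda f$ on $B(x,R)$. With $(f,g)_\mu=\sum_x f(x)g(x)\mu(x)$ let $$\rho(x,r,R)=\Bigl(\inf\bigl\{(-\Delta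 f,f)_\mu : f \text{ finitely supported},\ f=1 \text{ on } B(x,r),\ f=0 \text{ on } \Gamma\setminus B(x,R)\bigr\}\Bigr)^{-1}.$$ Assume: * $(p_0)$: there is $p_0>0$ with $\mu_{x,y}/\mu(x)\ge p_0$ whenever $x\sim y$; * $(VD)$: there is $D_V>0$ with $V(x,2R)\le D_V V(x,R)$ for all $x\in\Gamma$, $R>0$; * $(TC)$: there is $C_T>1$ with $E(x,2R)\le C_T\,E(y,R)$ for all $x\in\Gamma$, $R>0$, $y\in B(x,R)$. Write $a\simeq b$ for $C^{-1}a\le b\le Ca$. Then there is a constant $C>1$ such that for all $x\in\Gamma$ and all real $R>0$ $$\lambda^{-1}(x,2R)\simeq E(x,2R)\simeq\overline E(x,2R),$$ and, for all $x\in\Gamma$ and all real $R>\tfrac12$, moreover $$\overline E(x,2R)\simeq\rho(x,R,2R)\,v(x,R,2R)\qquad\text{and}\qquad E(x,2R)\simeq\rho(x,R,2R)\,v(x,R,2R)$$ (the last relation being the Einstein relation). -/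

import Mathlib

open MeasureTheory ProbabilityTheory
open scoped ENNReal NNReal

/-- A connected graph on the vertex set `V` with symmetric edge weights `μ_{x,y} > 0`, of finite
total weight at each vertex.  The weight function is extended by `0` to non-adjacent pairs. -/
structure WeightedGraph (V : Type*) where
  graph : SimpleGraph V
  connected : graph.Connected
  weight : V → V → ℝ
  weight_symm : ∀ x y, weight x y = weight y x
  weight_pos : ∀ x y, graph.Adj x y → 0 < weight x y
  weight_zero : ∀ x y, ¬ graph.Adj x y → weight x y = 0
  weight_summable : ∀ x, Summable (weight x)

namespace WeightedGraph

noncomputable section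

variable {V : Type*}

/-- `μ(x) = ∑_{y ∼ x} μ_{x,y}`. -/
def vertexMeasure (Γ : WeightedGraph V) (x : V) : ℝ := ∑' y, Γ.weight x y

/-- `μ(A) = ∑_{y ∈ A} μ(y)`. -/
def setMeasure (Γ : WeightedGraph V) (A : Set V) : ℝ≥0∞ :=
  ∑' y : A, ENNReal.ofReal (Γ.vertexMeasure y)

/-- The transition probabilities `P(x,y) = μ_{x,y} / μ(x)`. -/
def transition (Γ : WeightedGraph V) (x y : V) : ℝ := Γ.weight x y / Γ.vertexMeasure x

/-- The open ball `B(x,R)` of the graph distance. -/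
def ball (Γ : WeightedGraph V) (x : V) (R : ℝ) : Set V := {y | (Γ.graph.dist x y : ℝ) < R}

/-- `V(x,R) = μ(B(x,R))`. -/
def volume (Γ : WeightedGraph V) (x : V) (R : ℝ) : ℝ≥0∞ := Γ.setMeasure (Γ.ball x R)

/-- `v(x,r,R) = V(x,R) - V(x,r)`. -/
def annulusVolume (Γ : WeightedGraph V) (x : V) (r R : ℝ) : ℝ≥0∞ :=
  Γ.volume x R - Γ.volume x r

/-! ### The random walk -/

lemma weight_nonneg (Γ : WeightedGraph V) (x y : V) : 0 ≤ Γ.weight x y := by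
  by_cases h : Γ.graph.Adj x y
  · exact (Γ.weight_pos x y h).le
  · exact (Γ.weight_zero x y h).ge

lemma vertexMeasure_pos [Infinite V] (Γ : WeightedGraph V) (x : V) : 0 < Γ.vertexMeasure x := by
  obtain ⟨y, hy⟩ := Γ.connected.preconnected.exists_adj_of_nontrivial x
  exact (Γ.weight_summable x).tsum_pos (Γ.weight_nonneg x) y (Γ.weight_pos x y hy)

lemma transition_nonneg (Γ : WeightedGraph V) (x y : V) : 0 ≤ Γ.transition x y :=
  div_nonneg (Γ.weight_nonneg x y) (tsum_nonneg (Γ.weight_nonneg x))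

lemma hasSum_transition [Infinite V] (Γ : WeightedGraph V) (x : V) :
    HasSum (Γ.transition x) 1 := by
  have h := (Γ.weight_summable x).hasSum.div_const (Γ.vertexMeasure x)
  have h1 : (∑' y, Γ.weight x y) / Γ.vertexMeasure x = 1 := div_self (Γ.vertexMeasure_pos x).ne'
  rwa [h1] at h

/-- The distribution `P(x,·)` of one step of the walk from `x`. -/
def stepPMF [Infinite V] (Γ : WeightedGraph V) (x : V) : PMF V :=
  ⟨fun y => ENNReal.ofReal (Γ.transition x y), by
    have h := Γ.hasSum_transition x
    rw [ENNReal.summable.hasSum_iff,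
      ← ENNReal.ofReal_tsum_of_nonneg (Γ.transition_nonneg x) h.summable, h.tsum_eq,
      ENNReal.ofReal_one]⟩

variable [MeasurableSpace V] [DiscreteMeasurableSpace V]

/-- The transition kernel of the walk. -/
def stepKernel [Infinite V] (Γ : WeightedGraph V) : Kernel V V :=
  ⟨fun x => (Γ.stepPMF x).toMeasure, Measurable.of_discrete⟩

instance [Infinite V] (Γ : WeightedGraph V) : IsMarkovKernel Γ.stepKernel :=
  ⟨fun x => inferInstanceAs (IsProbabilityMeasure (Γ.stepPMF x).toMeasure)⟩

/-- The conditional distribution of `X_{n+1}` given `(X_0, …, X_n)`: it is `P(X_n,·)`. -/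
def historyKernel [Infinite V] (Γ : WeightedGraph V) (n : ℕ) :
    Kernel ((_ : Finset.Iic n) → V) V :=
  Γ.stepKernel.comap (fun h => h ⟨n, Finset.mem_Iic.2 le_rfl⟩) (measurable_pi_apply _)

instance [Infinite V] (Γ : WeightedGraph V) (n : ℕ) : IsMarkovKernel (Γ.historyKernel n) := by
  unfold historyKernel; infer_instance

/-- The law on trajectories `ω = (X_0, X_1, …)` of the random walk started at `z`. -/
def walkLaw [Infinite V] (Γ : WeightedGraph V) (z : V) : Measure (ℕ → V) :=
  Kernel.traj (X := fun _ => V) Γ.historyKernel 0 (fun _ => z)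

/-- The exit time `T_A = min {k : X_k ∉ A}` (infinite if the trajectory stays in `A`). -/
def exitTime {V : Type*} (A : Set V) (ω : ℕ → V) : ℝ≥0∞ := ⨅ (k : ℕ) (_ : ω k ∉ A), (k : ℝ≥0∞)

/-- `E_z(A)`, the mean exit time from `A` of the walk started at `z`. -/
def meanExitFrom [Infinite V] (Γ : WeightedGraph V) (z : V) (A : Set V) : ℝ≥0∞ :=
  ∫⁻ ω, exitTime A ω ∂(Γ.walkLaw z)

/-- `E(x,R) = E_x(B(x,R))`. -/
def meanExit [Infinite V] (Γ : WeightedGraph V) (x : V) (R : ℝ) : ℝ≥0∞ :=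
  Γ.meanExitFrom x (Γ.ball x R)

/-- `Ē(x,R) = max_{z ∈ B(x,R)} E_z(B(x,R))`. -/
def maxMeanExit [Infinite V] (Γ : WeightedGraph V) (x : V) (R : ℝ) : ℝ≥0∞ :=
  ⨆ z ∈ Γ.ball x R, Γ.meanExitFrom z (Γ.ball x R)

end

noncomputable section

variable {V : Type*}

/-! ### The Laplace operator, the bottom Dirichlet eigenvalue and the resistance -/

/-- `Δ f = P f - f`. -/
def laplacian (Γ : WeightedGraph V) (f : V → ℝ) (x : V) : ℝ :=
  (∑' y, Γ.transition x y * f y) - f x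

/-- The eigenvalues of `-Δ^A`, the operator `-Δ` with Dirichlet boundary conditions on `A`, acting
on the functions which vanish outside `A`. -/
def dirichletEigenvalues (Γ : WeightedGraph V) (A : Set V) : Set ℝ :=
  {l | ∃ f : V → ℝ, f ≠ 0 ∧ (∀ x ∉ A, f x = 0) ∧ ∀ x ∈ A, -Γ.laplacian f x = l * f x}

/-- `λ(A)`, the smallest eigenvalue of `-Δ^A` (for finite nonempty `A` the infimum is attained). -/
def bottomEigenvalue (Γ : WeightedGraph V) (A : Set V) : ℝ := sInf (Γ.dirichletEigenvalues A)

/-- `(f, g)_μ = ∑_x f(x) g(x) μ(x)`. -/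
def innerProduct (Γ : WeightedGraph V) (f g : V → ℝ) : ℝ :=
  ∑' x, f x * g x * Γ.vertexMeasure x

/-- The resistance `ρ(A,B) = (inf {(-Δ f, f)_μ : f|_A = 1, f|_B = 0})⁻¹`, where `f` runs through
the finitely supported functions. -/
def resistance (Γ : WeightedGraph V) (A B : Set V) : ℝ≥0∞ :=
  (⨅ (f : V → ℝ) (_ : f.support.Finite ∧ (∀ x ∈ A, f x = 1) ∧ ∀ x ∈ B, f x = 0),
    ENNReal.ofReal (Γ.innerProduct (fun x => -Γ.laplacian f x) f))⁻¹

/-- `ρ(x,r,R) = ρ(B(x,r), Γ \ B(x,R))`. -/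
def annulusResistance (Γ : WeightedGraph V) (x : V) (r R : ℝ) : ℝ≥0∞ :=
  Γ.resistance (Γ.ball x r) (Γ.ball x R)ᶜ

/-- `λ⁻¹(x,R)`, where `λ(x,R) = λ(B(x,R))`. -/
def invBottomEigenvalue (Γ : WeightedGraph V) (x : V) (R : ℝ) : ℝ≥0∞ :=
  (ENNReal.ofReal (Γ.bottomEigenvalue (Γ.ball x R)))⁻¹

/-! ### The conditions -/

/-- Condition `(p₀)`. -/
def ControlledWeights (Γ : WeightedGraph V) : Prop :=
  ∃ p₀ : ℝ, 0 < p₀ ∧ ∀ x y, Γ.graph.Adj x y → p₀ ≤ Γ.weight x y / Γ.vertexMeasure x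

/-- Volume doubling `(VD)`. -/
def VolumeDoubling (Γ : WeightedGraph V) : Prop :=
  ∃ D : ℝ≥0, 0 < D ∧ ∀ (x : V) (R : ℝ), 0 < R → Γ.volume x (2 * R) ≤ D * Γ.volume x R

/-- The time comparison principle `(TC)`. -/
def TimeComparison [MeasurableSpace V] [DiscreteMeasurableSpace V] [Infinite V]
    (Γ : WeightedGraph V) : Prop :=
  ∃ C : ℝ≥0, 1 < C ∧ ∀ (x : V) (R : ℝ), 0 < R → ∀ y ∈ Γ.ball x R,
    Γ.meanExit x (2 * R) ≤ C * Γ.meanExit y R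

/-- `C⁻¹ a ≤ b ≤ C a`. -/
def ComparableWith (C : ℝ≥0) (a b : ℝ≥0∞) : Prop := (C : ℝ≥0∞)⁻¹ * a ≤ b ∧ b ≤ C * a

end

end WeightedGraph

/-!
For a finite set `A`, the mean exit time `h(z) = E_z(A)` is the solution of the Dirichlet problem
`-Δ h = 1` on `A`, `h = 0` off `A`. The theorem rests on three inequalities for `B ⊆ A` finite:

* `λ(A)⁻¹ ≤ max_A h`, by comparing an eigenfunction `f` with `h` where `|f| / h` is maximal;
* `ρ(B, Aᶜ) μ(B) ≤ λ(A)⁻¹`, since `λ(A) μ(B) ≤ λ(A) (f, f) ≤ (-Δ f, f)` for every admissible `f`;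
* `min_B h ≤ ρ(B, Aᶜ) μ(A)`, by inserting the admissible function `f = min(h / a, 1)`,
  `a = min_B h`, whose energy is at most `(-Δ (h / a), f) ≤ μ(A) / a`.

For `A = B(x,2R)` and `B = B(x,R)`, time comparison makes `min_B h`, `E(x,2R)` and `max_A h`
comparable, and volume doubling makes `μ(A)` and `μ(B)` comparable, which closes the circle of
inequalities. For `R > 1/2` the annulus `A \ B` contains a ball of radius `R / 4`, so that its
volume is comparable with `μ(A)` too.
-/

namespace WeightedGraph

/-! ### The mean exit time as a Green potential -/

section Survival

variable {V : Type*}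

/-- The event that a trajectory stays in `A` up to and including time `k`, i.e. `T_A > k`. -/
def survival (A : Set V) (k : ℕ) : Set (ℕ → V) := {ω | ∀ i ≤ k, ω i ∈ A}

lemma exitTime_eq_tsum_indicator_survival (A : Set V) (ω : ℕ → V) :
    exitTime A ω = ∑' k, (survival A k).indicator 1 ω := by
  classical
  by_cases h : ∃ m, ω m ∉ A
  · have hstay (k : ℕ) : ω ∈ survival A k ↔ k ∈ Finset.range (Nat.find h) := by
      simp [survival]
    have hexit : exitTime A ω = (Nat.find h : ℝ≥0∞) :=
      le_antisymm (iInf₂_le (Nat.find h) (Nat.find_spec h))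
        (le_iInf₂ fun k hk => by exact_mod_cast Nat.find_min' h hk)
    rw [hexit, tsum_eq_sum (s := Finset.range (Nat.find h)) fun k hk => by simp [hstay, hk],
      Finset.sum_congr rfl fun k hk => by rw [Set.indicator_of_mem ((hstay k).2 hk)]]
    simp
  · push Not at h
    simp [exitTime, survival, h]

lemma exitTime_mono {A B : Set V} (h : A ⊆ B) (ω : ℕ → V) : exitTime A ω ≤ exitTime B ω :=
  le_iInf₂ fun k hk => iInf₂_le k fun hA => hk (h hA)

lemma survival_succ (A : Set V) (k : ℕ) :
    survival A (k + 1) = survival A k ∩ {ω | ω (k + 1) ∈ A} := by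
  ext ω
  simp [survival, Nat.le_succ_iff, or_imp, forall_and]

lemma survival_eq_preimage_frestrictLe (A : Set V) (k : ℕ) :
    survival A k = Preorder.frestrictLe (π := fun _ => V) k ⁻¹' Set.univ.pi fun _ => A := by
  ext ω
  simp [survival]

lemma measurableSet_survival [MeasurableSpace V] [DiscreteMeasurableSpace V] (A : Set V) (k : ℕ) :
    MeasurableSet (survival A k) := by
  rw [survival_eq_preimage_frestrictLe]
  exact Preorder.measurable_frestrictLe k (.univ_pi fun _ => .of_discrete)

end Survival

noncomputable section

variable {V : Type*} (Γ : WeightedGraph V)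

/-- The averaging operator `P` of the walk, acting on `[0, ∞]`-valued functions. -/
def averaging : (V → ℝ≥0∞) →ₗ[ℝ≥0∞] (V → ℝ≥0∞) where
  toFun g x := ∑' y, ENNReal.ofReal (Γ.transition x y) * g y
  map_add' f g := by
    ext x
    simp [mul_add, ENNReal.tsum_add]
  map_smul' c g := by
    ext x
    simp [mul_left_comm _ c, ENNReal.tsum_mul_left]

/-- The transition operator `g ↦ 1_A P g` of the walk killed on leaving `A`. -/
def killedStep (A : Set V) : (V → ℝ≥0∞) →ₗ[ℝ≥0∞] (V → ℝ≥0∞) where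
  toFun g := A.indicator (Γ.averaging g)
  map_add' f g := by rw [map_add, Set.indicator_add']
  map_smul' c g := by
    rw [map_smul]
    exact Set.indicator_const_smul A c _

variable {Γ}

lemma averaging_apply (g : V → ℝ≥0∞) (x : V) :
    Γ.averaging g x = ∑' y, ENNReal.ofReal (Γ.transition x y) * g y := rfl

lemma averaging_mono {f g : V → ℝ≥0∞} (h : f ≤ g) : Γ.averaging f ≤ Γ.averaging g :=
  fun _ => ENNReal.tsum_le_tsum fun y => by gcongr; exact h y

lemma averaging_tsum (f : ℕ → V → ℝ≥0∞) (x : V) :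
    Γ.averaging (fun y => ∑' k, f k y) x = ∑' k, Γ.averaging (f k) x := by
  simp only [averaging_apply, ← ENNReal.tsum_mul_left]
  exact ENNReal.tsum_comm

lemma averaging_ofReal {f : V → ℝ} (hf : ∀ y, 0 ≤ f y) {x : V}
    (hs : Summable fun y => Γ.transition x y * f y) :
    Γ.averaging (fun y => ENNReal.ofReal (f y)) x =
      ENNReal.ofReal (∑' y, Γ.transition x y * f y) := by
  rw [ENNReal.ofReal_tsum_of_nonneg (fun y => mul_nonneg (Γ.transition_nonneg x y) (hf y)) hs]
  simp only [averaging_apply, ENNReal.ofReal_mul (Γ.transition_nonneg x _)]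

lemma killedStep_of_mem {A : Set V} {z : V} (hz : z ∈ A) (g : V → ℝ≥0∞) :
    Γ.killedStep A g z = Γ.averaging g z :=
  Set.indicator_of_mem hz _

lemma killedStep_of_notMem {A : Set V} {z : V} (hz : z ∉ A) (g : V → ℝ≥0∞) :
    Γ.killedStep A g z = 0 :=
  Set.indicator_of_notMem hz _

variable (Γ) [Infinite V] [MeasurableSpace V] [DiscreteMeasurableSpace V]

lemma map_frestrictLe_zero_walkLaw (z : V) :
    (Γ.walkLaw z).map (Preorder.frestrictLe (π := fun _ => V) 0) =
      Measure.dirac fun _ => z := by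
  rw [walkLaw, Kernel.traj_map_frestrictLe_apply, Kernel.partialTraj_self, Kernel.id_apply]

lemma lintegral_walkLaw_zero (z : V) (g : V → ℝ≥0∞) : ∫⁻ ω, g (ω 0) ∂Γ.walkLaw z = g z := by
  have hg : Measurable g := .of_discrete
  have h := congrArg (fun ν => ∫⁻ h, g (h ⟨0, Finset.mem_Iic.2 le_rfl⟩) ∂ν)
    (Γ.map_frestrictLe_zero_walkLaw z)
  rw [lintegral_map (by fun_prop) (by fun_prop), lintegral_dirac' _ (by fun_prop)] at h
  exact h

variable {Γ} in
lemma meanExitFrom_mono (z : V) {A B : Set V} (h : A ⊆ B) :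
    Γ.meanExitFrom z A ≤ Γ.meanExitFrom z B :=
  lintegral_mono fun ω => exitTime_mono h ω

variable [Countable V]

lemma lintegral_stepKernel (g : V → ℝ≥0∞) (x : V) :
    ∫⁻ y, g y ∂Γ.stepKernel x = Γ.averaging g x := by
  rw [lintegral_countable', averaging_apply]
  refine tsum_congr fun y => ?_
  change _ * (Γ.stepPMF x).toMeasure {y} = _
  rw [PMF.toMeasure_apply_singleton _ _ (measurableSet_singleton y), mul_comm]
  rfl

/-- The Markov property at time `k`. -/
lemma setLIntegral_walkLaw_succ (z : V) {k : ℕ} {S : Set ((_ : Finset.Iic k) → V)}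
    (hS : MeasurableSet S) (g : V → ℝ≥0∞) :
    ∫⁻ ω in Preorder.frestrictLe (π := fun _ => V) k ⁻¹' S, g (ω (k + 1)) ∂Γ.walkLaw z =
      ∫⁻ ω in Preorder.frestrictLe (π := fun _ => V) k ⁻¹' S, Γ.averaging g (ω k)
        ∂Γ.walkLaw z := by
  have hg : Measurable g := .of_discrete
  have hPg : Measurable (Γ.averaging g) := .of_discrete
  have hlast : Measurable fun h : (_ : Finset.Iic k) → V =>
      Γ.averaging g (h ⟨k, Finset.mem_Iic.2 le_rfl⟩) := by fun_prop
  have hcond := Kernel.partialTraj_compProd_eq_map_traj (X := fun _ => V) (κ := Γ.historyKernel)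
    (Nat.zero_le k) (x₀ := fun _ => z)
  calc _ = ∫⁻ p in S ×ˢ Set.univ, g p.2 ∂(Γ.walkLaw z).map fun ω =>
        (Preorder.frestrictLe (π := fun _ => V) k ω, ω (k + 1)) := by
        rw [setLIntegral_map (hS.prod .univ) (by fun_prop) (by fun_prop), Set.prod_univ]
        rfl
    _ = ∫⁻ h in S, Γ.averaging g (h ⟨k, Finset.mem_Iic.2 le_rfl⟩)
        ∂(Γ.walkLaw z).map (Preorder.frestrictLe (π := fun _ => V) k) := by
        rw [walkLaw, ← hcond, Measure.setLIntegral_compProd (by fun_prop) hS .univ,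
          ← Kernel.traj_map_frestrictLe_apply]
        simp only [Measure.restrict_univ, historyKernel, Kernel.comap_apply, lintegral_stepKernel]
    _ = _ := setLIntegral_map hS hlast (by fun_prop)

lemma setLIntegral_survival (A : Set V) (z : V) (k : ℕ) (g : V → ℝ≥0∞) :
    ∫⁻ ω in survival A k, g (ω k) ∂Γ.walkLaw z = (Γ.killedStep A ^ k) (A.indicator g) z := by
  induction k generalizing g with
  | zero =>
    rw [pow_zero, Module.End.one_apply, ← Γ.lintegral_walkLaw_zero z (A.indicator g),
      ← lintegral_indicator (measurableSet_survival A 0)]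
    refine lintegral_congr fun ω => ?_
    by_cases h : ω 0 ∈ A <;> simp [survival, h]
  | succ k ih =>
    have hlast : MeasurableSet {ω : ℕ → V | ω (k + 1) ∈ A} :=
      measurable_pi_apply (k + 1) (.of_discrete : MeasurableSet A)
    calc ∫⁻ ω in survival A (k + 1), g (ω (k + 1)) ∂Γ.walkLaw z
        = ∫⁻ ω in survival A k, A.indicator g (ω (k + 1)) ∂Γ.walkLaw z := by
          rw [survival_succ, Set.inter_comm, ← setLIntegral_indicator hlast]
          rfl
      _ = ∫⁻ ω in survival A k, Γ.averaging (A.indicator g) (ω k) ∂Γ.walkLaw z := by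
          rw [survival_eq_preimage_frestrictLe]
          exact Γ.setLIntegral_walkLaw_succ z (.univ_pi fun _ => .of_discrete) _
      _ = (Γ.killedStep A ^ (k + 1)) (A.indicator g) z := by
          rw [ih, pow_succ]
          rfl

lemma meanExitFrom_eq_tsum (A : Set V) (z : V) :
    Γ.meanExitFrom z A = ∑' k, (Γ.killedStep A ^ k) (A.indicator 1) z := by
  simp only [meanExitFrom, exitTime_eq_tsum_indicator_survival]
  rw [lintegral_tsum fun k =>
    (measurable_one.indicator (measurableSet_survival A k)).aemeasurable]
  refine tsum_congr fun k => ?_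
  rw [lintegral_indicator (measurableSet_survival A k), ← Γ.setLIntegral_survival A z k 1]
  rfl

variable {Γ} {A : Set V} {z : V}

lemma meanExitFrom_of_mem (hz : z ∈ A) :
    Γ.meanExitFrom z A = 1 + Γ.averaging (fun y => Γ.meanExitFrom y A) z := by
  simp only [meanExitFrom_eq_tsum]
  rw [tsum_eq_zero_add' ENNReal.summable, averaging_tsum]
  simp [pow_succ', killedStep_of_mem, hz]

lemma meanExitFrom_of_notMem (hz : z ∉ A) : Γ.meanExitFrom z A = 0 := by
  rw [meanExitFrom_eq_tsum, ENNReal.tsum_eq_zero]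
  rintro (_ | k)
  · simp [hz]
  · simp [pow_succ', killedStep_of_notMem, hz]

lemma one_le_meanExitFrom (hz : z ∈ A) : 1 ≤ Γ.meanExitFrom z A := by
  rw [meanExitFrom_of_mem hz]
  exact le_self_add

lemma meanExitFrom_le_of_supersolution {w : V → ℝ≥0∞}
    (hw : ∀ z ∈ A, 1 + Γ.averaging w z ≤ w z) (z : V) : Γ.meanExitFrom z A ≤ w z := by
  rw [meanExitFrom_eq_tsum]
  refine ENNReal.tsum_le_of_sum_range_le fun n => ?_
  rw [← Finset.sum_apply]
  induction n generalizing z with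
  | zero => simp
  | succ n ih =>
    have hsum : ∑ k ∈ Finset.range (n + 1), (Γ.killedStep A ^ k) (A.indicator 1) =
        A.indicator 1 +
          Γ.killedStep A (∑ k ∈ Finset.range n, (Γ.killedStep A ^ k) (A.indicator 1)) := by
      simp [Finset.sum_range_succ', pow_succ', add_comm]
    rw [hsum, Pi.add_apply]
    by_cases hz : z ∈ A
    · rw [Set.indicator_of_mem hz, killedStep_of_mem hz]
      exact (add_le_add_right (averaging_mono ih z) 1).trans (hw z hz)
    · simp [hz, killedStep_of_notMem]

end

noncomputable section

variable {V : Type*} {Γ : WeightedGraph V}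

/-! ### The Dirichlet problem on a finite set -/

/-- The functions vanishing off `A`, on which the Laplacian with Dirichlet boundary conditions
acts. They are kept as functions on all of `V`, so that `Γ.laplacian` applies to them. -/
def dirichletSpace (A : Set V) : Submodule ℝ (V → ℝ) where
  carrier := {f | ∀ x ∉ A, f x = 0}
  add_mem' hf hg x hx := by simp [hf x hx, hg x hx]
  zero_mem' _ _ := rfl
  smul_mem' c f hf x hx := by simp [hf x hx]

lemma indicator_mem_dirichletSpace (A : Set V) (f : V → ℝ) : A.indicator f ∈ dirichletSpace A :=
  fun _ hx => Set.indicator_of_notMem hx f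

instance (A : Set V) [Finite A] : FiniteDimensional ℝ (dirichletSpace A) := by
  refine Module.Finite.of_injective
    (LinearMap.funLeft ℝ ℝ ((↑) : A → V) ∘ₗ (dirichletSpace A).subtype) fun f g hfg => ?_
  ext x
  by_cases hx : x ∈ A
  · exact congrFun hfg ⟨x, hx⟩
  · rw [f.2 x hx, g.2 x hx]

lemma summable_transition_mul {A : Set V} [Finite A] {f : V → ℝ} (hf : f ∈ dirichletSpace A)
    (x : V) : Summable fun y => Γ.transition x y * f y :=
  summable_of_hasFiniteSupport <| A.toFinite.subset fun y hy => by
    by_contra hyA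
    simp [hf y hyA] at hy

lemma laplacian_smul (c : ℝ) (f : V → ℝ) : Γ.laplacian (c • f) = c • Γ.laplacian f := by
  ext x
  simp [laplacian, mul_left_comm _ c, tsum_mul_left, mul_sub]

lemma laplacian_neg (f : V → ℝ) : Γ.laplacian (-f) = -Γ.laplacian f := by
  simpa using Γ.laplacian_smul (-1) f

lemma laplacian_add {f g : V → ℝ} {x : V} (hf : Summable fun y => Γ.transition x y * f y)
    (hg : Summable fun y => Γ.transition x y * g y) :
    Γ.laplacian (f + g) x = Γ.laplacian f x + Γ.laplacian g x := by
  simp only [laplacian, Pi.add_apply, mul_add, hf.tsum_add hg]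
  ring

/-- The operator `-Δ` with Dirichlet boundary conditions on `A`. -/
def dirichletOperator (Γ : WeightedGraph V) (A : Set V) [Finite A] :
    dirichletSpace A →ₗ[ℝ] dirichletSpace A where
  toFun f := ⟨A.indicator (-Γ.laplacian f), indicator_mem_dirichletSpace A _⟩
  map_add' f g := by
    ext x
    by_cases hx : x ∈ A
    · simp [hx, laplacian_add (summable_transition_mul f.2 x) (summable_transition_mul g.2 x),
        add_comm]
    · simp [hx]
  map_smul' c f := by
    ext x
    by_cases hx : x ∈ A <;> simp [hx, laplacian_smul]

lemma dirichletOperator_apply_of_mem {A : Set V} [Finite A] (f : dirichletSpace A) {x : V}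
    (hx : x ∈ A) : (Γ.dirichletOperator A f : V → ℝ) x = -Γ.laplacian f x :=
  Set.indicator_of_mem hx _

variable [Infinite V]

lemma laplacian_nonpos_of_forall_le {f : V → ℝ} {x : V}
    (hf : Summable fun y => Γ.transition x y * f y) (hmax : ∀ y, f y ≤ f x) :
    Γ.laplacian f x ≤ 0 := by
  have hP := Γ.hasSum_transition x
  have hle := hf.tsum_le_tsum
    (fun y => mul_le_mul_of_nonneg_left (hmax y) (Γ.transition_nonneg x y))
    (hP.summable.mul_right (f x))
  rw [tsum_mul_right, hP.tsum_eq, one_mul] at hle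
  exact sub_nonpos.2 hle

lemma eq_of_adj_of_forall_le {f : V → ℝ} {x y : V}
    (hf : Summable fun y => Γ.transition x y * f y) (hmax : ∀ y, f y ≤ f x)
    (hΔ : 0 ≤ Γ.laplacian f x) (hxy : Γ.graph.Adj x y) : f y = f x := by
  have hP := Γ.hasSum_transition x
  have hpos : 0 < Γ.transition x y := div_pos (Γ.weight_pos x y hxy) (Γ.vertexMeasure_pos x)
  refine (hmax y).eq_of_not_lt fun hlt => ?_
  have hlt' := hf.tsum_lt_tsum
    (fun y => mul_le_mul_of_nonneg_left (hmax y) (Γ.transition_nonneg x y))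
    (mul_lt_mul_of_pos_left hlt hpos) (hP.summable.mul_right (f x))
  rw [tsum_mul_right, hP.tsum_eq, one_mul] at hlt'
  exact (sub_neg.2 hlt').not_ge hΔ

variable {A : Set V} [Finite A]

lemma nonpos_of_laplacian_nonneg {u : V → ℝ} (hu : u ∈ dirichletSpace A)
    (hΔ : ∀ x ∈ A, 0 ≤ Γ.laplacian u x) (x : V) : u x ≤ 0 := by
  by_contra! hx
  have mem_of_pos {y : V} (hy : 0 < u y) : y ∈ A := by
    by_contra hyA
    exact hy.ne' (hu y hyA)
  obtain ⟨z, -, hz⟩ := A.exists_max_image u A.toFinite ⟨x, mem_of_pos hx⟩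
  have hz0 : 0 < u z := hx.trans_le (hz x (mem_of_pos hx))
  have hmax (y : V) : u y ≤ u z := by
    by_cases hy : y ∈ A
    · exact hz y hy
    · exact (hu y hy).trans_le hz0.le
  obtain ⟨o, ho⟩ := A.toFinite.exists_notMem
  obtain ⟨p⟩ := Γ.connected.preconnected z o
  obtain ⟨d, -, hd, hd'⟩ := p.exists_boundary_dart {y | u y = u z} rfl
    fun h : u o = u z => hz0.ne' (h.symm.trans (hu o ho))
  have hd : u d.fst = u z := hd
  refine hd' ((eq_of_adj_of_forall_le (summable_transition_mul hu _) (fun y => ?_)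
    (hΔ _ (mem_of_pos (hd ▸ hz0))) d.adj).trans hd)
  exact hd ▸ hmax y

lemma nonneg_of_laplacian_nonpos {u : V → ℝ} (hu : u ∈ dirichletSpace A)
    (hΔ : ∀ x ∈ A, Γ.laplacian u x ≤ 0) (x : V) : 0 ≤ u x :=
  neg_nonpos.1 <| nonpos_of_laplacian_nonneg (Γ := Γ) (neg_mem hu)
    (fun y hy => by simpa [laplacian_neg] using hΔ y hy) x

lemma dirichletOperator_injective : Function.Injective (Γ.dirichletOperator A) := by
  rw [injective_iff_map_eq_zero]
  intro f hf
  have hΔ (x : V) (hx : x ∈ A) : Γ.laplacian f x = 0 := by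
    rw [← neg_eq_zero, ← dirichletOperator_apply_of_mem f hx, hf]
    rfl
  ext x
  exact le_antisymm (nonpos_of_laplacian_nonneg f.2 (fun y hy => (hΔ y hy).ge) x)
    (nonneg_of_laplacian_nonpos f.2 (fun y hy => (hΔ y hy).le) x)

variable (Γ A) in
lemma exists_neg_laplacian_eq (g : V → ℝ) :
    ∃ u ∈ dirichletSpace A, ∀ x ∈ A, -Γ.laplacian u x = g x := by
  obtain ⟨u, hu⟩ := LinearMap.injective_iff_surjective.1
    (dirichletOperator_injective (Γ := Γ)) ⟨A.indicator g, indicator_mem_dirichletSpace A g⟩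
  refine ⟨u, u.2, fun x hx => ?_⟩
  rw [← dirichletOperator_apply_of_mem u hx, hu]
  exact Set.indicator_of_mem hx g

end

/-! ### The mean exit time as a solution of the Poisson equation -/

noncomputable section

variable {V : Type*} [Infinite V] [MeasurableSpace V] [DiscreteMeasurableSpace V]
  {Γ : WeightedGraph V} {A : Set V}

/-- The mean exit time from `A` as a real function of the starting point, for finite `A`
(elsewhere an infinite mean exit time is read as `0`). -/
def exitFunction (Γ : WeightedGraph V) (A : Set V) (z : V) : ℝ := (Γ.meanExitFrom z A).toReal

lemma exitFunction_nonneg (z : V) : 0 ≤ Γ.exitFunction A z := ENNReal.toReal_nonneg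

variable [Countable V]

lemma exitFunction_mem_dirichletSpace : Γ.exitFunction A ∈ dirichletSpace A := fun z hz => by
  simp [exitFunction, meanExitFrom_of_notMem hz]

variable [Finite A]

lemma meanExitFrom_ne_top (z : V) : Γ.meanExitFrom z A ≠ ∞ := by
  obtain ⟨u, hu, hΔ⟩ := Γ.exists_neg_laplacian_eq A 1
  have hu0 : ∀ x, 0 ≤ u x := nonneg_of_laplacian_nonpos hu fun x hx => by
    rw [← neg_nonneg, hΔ x hx]
    exact zero_le_one
  refine ne_top_of_le_ne_top ENNReal.ofReal_ne_top
    (meanExitFrom_le_of_supersolution (w := fun y => ENNReal.ofReal (u y)) (fun x hx => ?_) z)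
  have hPu : 0 ≤ ∑' y, Γ.transition x y * u y :=
    tsum_nonneg fun y => mul_nonneg (Γ.transition_nonneg x y) (hu0 y)
  have hux : 1 + ∑' y, Γ.transition x y * u y = u x := by
    have := hΔ x hx
    simp only [laplacian, Pi.one_apply] at this
    linarith
  rw [averaging_ofReal hu0 (summable_transition_mul hu x), ← ENNReal.ofReal_one,
    ← ENNReal.ofReal_add zero_le_one hPu, hux]

lemma ofReal_exitFunction (z : V) :
    ENNReal.ofReal (Γ.exitFunction A z) = Γ.meanExitFrom z A :=
  ENNReal.ofReal_toReal (meanExitFrom_ne_top z)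

lemma exitFunction_pos {z : V} (hz : z ∈ A) : 0 < Γ.exitFunction A z :=
  ENNReal.toReal_pos (zero_lt_one.trans_le (one_le_meanExitFrom hz)).ne' (meanExitFrom_ne_top z)

lemma neg_laplacian_exitFunction {z : V} (hz : z ∈ A) :
    -Γ.laplacian (Γ.exitFunction A) z = 1 := by
  have hfirst := meanExitFrom_of_mem (Γ := Γ) hz
  have hPh : 0 ≤ ∑' y, Γ.transition z y * Γ.exitFunction A y :=
    tsum_nonneg fun y => mul_nonneg (Γ.transition_nonneg z y) (exitFunction_nonneg y)
  simp only [← ofReal_exitFunction] at hfirst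
  rw [averaging_ofReal exitFunction_nonneg
    (summable_transition_mul exitFunction_mem_dirichletSpace z), ← ENNReal.ofReal_one,
    ← ENNReal.ofReal_add zero_le_one hPh,
    ENNReal.ofReal_eq_ofReal_iff (exitFunction_nonneg z) (by positivity)] at hfirst
  rw [laplacian, hfirst]
  ring

end

noncomputable section

variable {V : Type*} {Γ : WeightedGraph V}

/-! ### The Dirichlet form -/

lemma innerProduct_comm (f g : V → ℝ) : Γ.innerProduct f g = Γ.innerProduct g f :=
  tsum_congr fun x => by rw [mul_comm (f x)]

lemma innerProduct_smul_left (c : ℝ) (f g : V → ℝ) :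
    Γ.innerProduct (c • f) g = c * Γ.innerProduct f g := by
  simp [innerProduct, mul_assoc, tsum_mul_left]

lemma vertexMeasure_nonneg (x : V) : 0 ≤ Γ.vertexMeasure x := tsum_nonneg (Γ.weight_nonneg x)

lemma innerProduct_self_nonneg (f : V → ℝ) : 0 ≤ Γ.innerProduct f f :=
  tsum_nonneg fun x => mul_nonneg (mul_self_nonneg _) (vertexMeasure_nonneg x)

lemma setMeasure_ne_zero [Infinite V] {A : Set V} {x : V} (hx : x ∈ A) : Γ.setMeasure A ≠ 0 :=
  fun h => (Γ.vertexMeasure_pos x).not_ge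
    (ENNReal.ofReal_eq_zero.1 (ENNReal.tsum_eq_zero.1 h ⟨x, hx⟩))

section Sum

variable {A : Set V} [Fintype A]

lemma tsum_eq_sum_of_mem_dirichletSpace {f : V → ℝ} (hf : f ∈ dirichletSpace A) :
    ∑' x, f x = ∑ x : A, f x := by
  have hsupp : f.support ⊆ A := fun x hx => by
    by_contra hxA
    exact hx (hf x hxA)
  rw [← tsum_subtype_eq_of_support_subset hsupp, tsum_fintype]

lemma innerProduct_eq_sum (f : V → ℝ) {g : V → ℝ} (hg : g ∈ dirichletSpace A) :
    Γ.innerProduct f g = ∑ x : A, f x * g x * Γ.vertexMeasure x :=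
  tsum_eq_sum_of_mem_dirichletSpace fun x hx => by simp [hg x hx]

lemma laplacian_eq_sum {f : V → ℝ} (hf : f ∈ dirichletSpace A) (x : V) :
    Γ.laplacian f x = ∑ y : A, Γ.transition x y * f y - f x :=
  congrArg (· - f x) (tsum_eq_sum_of_mem_dirichletSpace fun y hy => by simp [hf y hy])

lemma setMeasure_eq_ofReal_sum :
    Γ.setMeasure A = ENNReal.ofReal (∑ x : A, Γ.vertexMeasure x) := by
  rw [setMeasure, tsum_fintype, ENNReal.ofReal_sum_of_nonneg fun x _ => vertexMeasure_nonneg _]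

end Sum

variable {A : Set V} [Finite A]

lemma setMeasure_ne_top : Γ.setMeasure A ≠ ∞ := by
  cases nonempty_fintype A
  rw [setMeasure_eq_ofReal_sum]
  exact ENNReal.ofReal_ne_top

lemma innerProduct_add_left (f g : V → ℝ) {h : V → ℝ} (hh : h ∈ dirichletSpace A) :
    Γ.innerProduct (f + g) h = Γ.innerProduct f h + Γ.innerProduct g h := by
  cases nonempty_fintype A
  simp only [innerProduct_eq_sum _ hh, Pi.add_apply, add_mul, Finset.sum_add_distrib]

lemma innerProduct_dirichletOperator (f g : dirichletSpace A) :
    Γ.innerProduct (Γ.dirichletOperator A f) g = Γ.innerProduct (-Γ.laplacian f) g := by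
  cases nonempty_fintype A
  simp only [innerProduct_eq_sum _ g.2]
  exact Finset.sum_congr rfl fun x _ => by
    rw [dirichletOperator_apply_of_mem f x.2, Pi.neg_apply]

lemma mul_innerProduct_self_of_eigenfunction {f : V → ℝ} (hf : f ∈ dirichletSpace A) {l : ℝ}
    (hl : ∀ x ∈ A, -Γ.laplacian f x = l * f x) :
    l * Γ.innerProduct f f = Γ.innerProduct (-Γ.laplacian f) f := by
  cases nonempty_fintype A
  rw [← innerProduct_smul_left, innerProduct_eq_sum _ hf, innerProduct_eq_sum _ hf]
  exact Finset.sum_congr rfl fun x _ => by simp [← hl x x.2]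

variable [Infinite V]

lemma innerProduct_self_pos {f : V → ℝ} (hf : f ∈ dirichletSpace A) (hf0 : f ≠ 0) :
    0 < Γ.innerProduct f f := by
  cases nonempty_fintype A
  obtain ⟨x, hx⟩ := Function.ne_iff.1 hf0
  have hxA : x ∈ A := by
    by_contra hxA
    exact hx (hf x hxA)
  rw [innerProduct_eq_sum f hf]
  exact Finset.sum_pos' (fun y _ => mul_nonneg (mul_self_nonneg _) (Γ.vertexMeasure_pos y).le)
    ⟨⟨x, hxA⟩, Finset.mem_univ _, mul_pos (mul_self_pos.2 hx) (Γ.vertexMeasure_pos x)⟩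

lemma innerProduct_neg_laplacian_comm {f g : V → ℝ} (hf : f ∈ dirichletSpace A)
    (hg : g ∈ dirichletSpace A) :
    Γ.innerProduct (-Γ.laplacian f) g = Γ.innerProduct (-Γ.laplacian g) f := by
  cases nonempty_fintype A
  have hΔ {f g : V → ℝ} (hf : f ∈ dirichletSpace A) (hg : g ∈ dirichletSpace A) :
      Γ.innerProduct (-Γ.laplacian f) g = ∑ x : A, f x * g x * Γ.vertexMeasure x -
        ∑ x : A, ∑ y : A, Γ.weight x y * (f y * g x) := by
    rw [innerProduct_eq_sum _ hg, ← Finset.sum_sub_distrib]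
    refine Finset.sum_congr rfl fun x _ => ?_
    have hw (y : V) : Γ.weight x y = Γ.transition x y * Γ.vertexMeasure x :=
      (div_mul_cancel₀ _ (Γ.vertexMeasure_pos x).ne').symm
    simp only [Pi.neg_apply, laplacian_eq_sum hf, hw, neg_sub, sub_mul, Finset.sum_mul]
    congr 1
    exact Finset.sum_congr rfl fun y _ => by ring
  rw [hΔ hf hg, hΔ hg hf, Finset.sum_comm]
  simp only [Γ.weight_symm, mul_comm]

/-- At a point where `u > 1` the truncation `u ⊓ 1` attains its maximum, so that
`-Δ (u ⊓ 1) ≥ 0` there. -/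
lemma innerProduct_neg_laplacian_inf_one_le {u : V → ℝ} (hu : u ∈ dirichletSpace A) :
    Γ.innerProduct (-Γ.laplacian (u ⊓ 1)) (u ⊓ 1) ≤
      Γ.innerProduct (-Γ.laplacian u) (u ⊓ 1) := by
  cases nonempty_fintype A
  have hm : u ⊓ 1 ∈ dirichletSpace A := fun x hx => by simp [hu x hx]
  rw [innerProduct_neg_laplacian_comm hu hm, innerProduct_eq_sum _ hm, innerProduct_eq_sum _ hu]
  refine Finset.sum_le_sum fun x _ =>
    mul_le_mul_of_nonneg_right ?_ (Γ.vertexMeasure_pos x).le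
  rcases le_total (u x) 1 with hx | hx
  · simp [hx]
  · have hΔ := laplacian_nonpos_of_forall_le (Γ := Γ) (x := x) (summable_transition_mul hm x)
      fun y => by simp [hx]
    exact mul_le_mul_of_nonneg_left inf_le_left (neg_nonneg.2 hΔ)

/-! ### The bottom Dirichlet eigenvalue -/

variable (Γ A) in
/-- The scalar product `(·,·)_μ` makes `dirichletSpace A` a Euclidean space, in which `-Δ` is
symmetric. -/
abbrev dirichletCore : InnerProductSpace.Core ℝ (dirichletSpace A) where
  inner f g := Γ.innerProduct f g
  conj_inner_symm f g := innerProduct_comm _ _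
  re_inner_nonneg f := innerProduct_self_nonneg _
  add_left f g h := innerProduct_add_left _ _ h.2
  smul_left f g c := innerProduct_smul_left _ _ _
  definite f hf := by
    by_contra hf0
    exact (innerProduct_self_pos (Γ := Γ) f.2 (by simpa using hf0)).ne' hf

end

open scoped InnerProductSpace in
lemma exists_hasEigenvalue_mul_inner_le {E : Type*} [NormedAddCommGroup E]
    [InnerProductSpace ℝ E] [FiniteDimensional ℝ E] [Nontrivial E] {T : E →ₗ[ℝ] E}
    (hT : T.IsSymmetric) :
    ∃ l : ℝ, Module.End.HasEigenvalue T l ∧ ∀ v, l * ⟪v, v⟫_ℝ ≤ ⟪T v, v⟫_ℝ := by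
  let b := hT.eigenvectorBasis rfl
  have : Nonempty (Fin (Module.finrank ℝ E)) := ⟨⟨0, Module.finrank_pos⟩⟩
  obtain ⟨i, hi⟩ := Finite.exists_min (hT.eigenvalues rfl)
  refine ⟨hT.eigenvalues rfl i, hT.hasEigenvalue_eigenvalues rfl i, fun v => ?_⟩
  rw [← b.sum_inner_mul_inner, ← b.sum_inner_mul_inner, Finset.mul_sum]
  refine Finset.sum_le_sum fun j _ => ?_
  have hj : ⟪T v, b j⟫_ℝ = hT.eigenvalues rfl j * ⟪v, b j⟫_ℝ := by
    rw [hT v (b j), hT.apply_eigenvectorBasis rfl j]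
    exact inner_smul_right _ _ _
  rw [hj, mul_assoc, real_inner_comm v]
  exact mul_le_mul_of_nonneg_right (hi j) (mul_self_nonneg _)

noncomputable section

variable {V : Type*} [Infinite V] {Γ : WeightedGraph V} {A : Set V} [Finite A]

lemma exists_dirichletEigenvalue_mul_innerProduct_le (hA : A.Nonempty) :
    ∃ l ∈ Γ.dirichletEigenvalues A, ∀ f ∈ dirichletSpace A,
      l * Γ.innerProduct f f ≤ Γ.innerProduct (-Γ.laplacian f) f := by
  let := (Γ.dirichletCore A).toNormedAddCommGroup
  let : InnerProductSpace ℝ (dirichletSpace A) := .ofCore (Γ.dirichletCore A).toCore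
  have : Nontrivial (dirichletSpace A) := by
    obtain ⟨x, hx⟩ := hA
    refine ⟨⟨A.indicator 1, indicator_mem_dirichletSpace A 1⟩, 0, fun h => ?_⟩
    simpa [hx] using congrFun (congrArg Subtype.val h) x
  have hsymm : (Γ.dirichletOperator A).IsSymmetric := fun f g => by
    change Γ.innerProduct _ _ = Γ.innerProduct _ _
    rw [innerProduct_dirichletOperator, innerProduct_comm (f : V → ℝ),
      innerProduct_dirichletOperator, innerProduct_neg_laplacian_comm f.2 g.2]
  obtain ⟨l, hl, hle⟩ := exists_hasEigenvalue_mul_inner_le hsymm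
  refine ⟨l, ?_, fun f hf => ?_⟩
  · obtain ⟨f, hf⟩ := hl.exists_hasEigenvector
    refine ⟨f, by simpa using hf.2, f.2, fun x hx => ?_⟩
    rw [← dirichletOperator_apply_of_mem f hx, hf.apply_eq_smul]
    rfl
  · rw [← innerProduct_dirichletOperator ⟨f, hf⟩ ⟨f, hf⟩]
    exact hle ⟨f, hf⟩

lemma exists_isLeast_dirichletEigenvalues (hA : A.Nonempty) :
    ∃ l, IsLeast (Γ.dirichletEigenvalues A) l ∧ ∀ f ∈ dirichletSpace A,
      l * Γ.innerProduct f f ≤ Γ.innerProduct (-Γ.laplacian f) f := by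
  obtain ⟨l, hl, hle⟩ := exists_dirichletEigenvalue_mul_innerProduct_le (Γ := Γ) hA
  refine ⟨l, ⟨hl, ?_⟩, hle⟩
  rintro l' ⟨f, hf0, hf, hl'⟩
  refine le_of_mul_le_mul_right ?_ (innerProduct_self_pos (Γ := Γ) hf hf0)
  rw [mul_innerProduct_self_of_eigenfunction hf hl']
  exact hle f hf

lemma bottomEigenvalue_mem_dirichletEigenvalues (hA : A.Nonempty) :
    Γ.bottomEigenvalue A ∈ Γ.dirichletEigenvalues A := by
  obtain ⟨l, hl, -⟩ := exists_isLeast_dirichletEigenvalues (Γ := Γ) hA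
  rw [bottomEigenvalue, hl.csInf_eq]
  exact hl.1

lemma bottomEigenvalue_mul_innerProduct_le (hA : A.Nonempty) {f : V → ℝ}
    (hf : f ∈ dirichletSpace A) :
    Γ.bottomEigenvalue A * Γ.innerProduct f f ≤ Γ.innerProduct (-Γ.laplacian f) f := by
  obtain ⟨l, hl, hle⟩ := exists_isLeast_dirichletEigenvalues (Γ := Γ) hA
  rw [bottomEigenvalue, hl.csInf_eq]
  exact hle f hf

end

noncomputable section

variable {V : Type*} [Infinite V] {Γ : WeightedGraph V} {A B : Set V} [Finite A]

/-! ### Comparison of eigenvalue, resistance and mean exit time on a finite set -/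

lemma bottomEigenvalue_mul_setMeasure_le (hA : A.Nonempty) {f : V → ℝ}
    (hf : f ∈ dirichletSpace A) (hfB : ∀ x ∈ B, f x = 1) :
    ENNReal.ofReal (Γ.bottomEigenvalue A) * Γ.setMeasure B ≤
      ENNReal.ofReal (Γ.innerProduct (-Γ.laplacian f) f) := by
  have hnn (x : V) : 0 ≤ f x * f x * Γ.vertexMeasure x :=
    mul_nonneg (mul_self_nonneg _) (vertexMeasure_nonneg x)
  have hsum : Summable fun x => f x * f x * Γ.vertexMeasure x :=
    summable_of_hasFiniteSupport <| A.toFinite.subset fun x hx => by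
      by_contra hxA
      simp [hf x hxA] at hx
  have hB : Γ.setMeasure B ≤ ENNReal.ofReal (Γ.innerProduct f f) := by
    rw [innerProduct, ENNReal.ofReal_tsum_of_nonneg hnn hsum, setMeasure]
    refine le_trans (le_of_eq (tsum_congr fun x => ?_))
      (ENNReal.tsum_comp_le_tsum_of_injective (Subtype.val_injective (p := (· ∈ B))) _)
    rw [hfB x x.2, one_mul, one_mul]
  calc _ ≤ ENNReal.ofReal (Γ.bottomEigenvalue A) * ENNReal.ofReal (Γ.innerProduct f f) := by gcongr
    _ = ENNReal.ofReal (Γ.bottomEigenvalue A * Γ.innerProduct f f) :=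
      (ENNReal.ofReal_mul' (innerProduct_self_nonneg f)).symm
    _ ≤ _ := ENNReal.ofReal_le_ofReal (bottomEigenvalue_mul_innerProduct_le hA hf)

lemma resistance_mul_setMeasure_le_inv_bottomEigenvalue (hA : A.Nonempty) (hBA : B ⊆ A) :
    Γ.resistance B Aᶜ * Γ.setMeasure B ≤ (ENNReal.ofReal (Γ.bottomEigenvalue A))⁻¹ := by
  have : Finite B := A.toFinite.subset hBA
  have hcap : ENNReal.ofReal (Γ.bottomEigenvalue A) * Γ.setMeasure B ≤ (Γ.resistance B Aᶜ)⁻¹ := by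
    rw [resistance, inv_inv]
    exact le_iInf₂ fun f hf => bottomEigenvalue_mul_setMeasure_le hA hf.2.2 hf.2.1
  calc Γ.resistance B Aᶜ * Γ.setMeasure B
      ≤ (ENNReal.ofReal (Γ.bottomEigenvalue A) * Γ.setMeasure B)⁻¹ * Γ.setMeasure B := by
        gcongr
        exact ENNReal.le_inv_iff_le_inv.1 hcap
    _ = (ENNReal.ofReal (Γ.bottomEigenvalue A))⁻¹ * ((Γ.setMeasure B)⁻¹ * Γ.setMeasure B) := by
        rw [ENNReal.mul_inv (.inr setMeasure_ne_top) (.inl ENNReal.ofReal_ne_top), mul_assoc]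
    _ ≤ _ := mul_le_of_le_one_right' (ENNReal.inv_mul_le_one _)

variable [Countable V] [MeasurableSpace V] [DiscreteMeasurableSpace V]

lemma le_neg_laplacian_of_forall_le_mul_exitFunction {f : V → ℝ} (hf : f ∈ dirichletSpace A)
    {t : ℝ} (hle : ∀ y, f y ≤ t * Γ.exitFunction A y) {z : V} (hz : z ∈ A)
    (htouch : f z = t * Γ.exitFunction A z) : t ≤ -Γ.laplacian f z := by
  have hth : (-t) • Γ.exitFunction A ∈ dirichletSpace A :=
    Submodule.smul_mem _ _ exitFunction_mem_dirichletSpace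
  have hΔ := laplacian_nonpos_of_forall_le (Γ := Γ) (x := z)
    (summable_transition_mul (add_mem hf hth) z) fun y => by simpa [htouch] using hle y
  rw [laplacian_add (summable_transition_mul hf z) (summable_transition_mul hth z),
    laplacian_smul, Pi.smul_apply, smul_eq_mul, neg_mul_comm, neg_laplacian_exitFunction hz] at hΔ
  linarith

/-- Barta's argument: an eigenfunction `f` is compared with the mean exit time `h` at a maximum
point of `|f| / h`. -/
lemma exists_one_le_mul_exitFunction {l : ℝ} (hl : l ∈ Γ.dirichletEigenvalues A) :
    ∃ z ∈ A, 1 ≤ l * Γ.exitFunction A z := by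
  obtain ⟨f, hf0, hf : f ∈ dirichletSpace A, hl⟩ := hl
  have hh {y : V} (hy : y ∈ A) : 0 < Γ.exitFunction A y := exitFunction_pos hy
  obtain ⟨x, hx⟩ := Function.ne_iff.1 hf0
  have hxA : x ∈ A := by
    by_contra hxA
    exact hx (hf x hxA)
  obtain ⟨z, hz, hmax⟩ :=
    A.exists_max_image (fun y => |f y| / Γ.exitFunction A y) A.toFinite ⟨x, hxA⟩
  have hfz : f z ≠ 0 := abs_pos.1 <| (div_pos_iff_of_pos_right (hh hz)).1 <|
    (div_pos (abs_pos.2 hx) (hh hxA)).trans_le (hmax x hxA)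
  refine ⟨z, hz, ?_⟩
  clear hx hf0
  wlog hpos : 0 < f z generalizing f
  · refine this (-f) (neg_mem hf) (fun y hy => ?_) (by simpa using hmax) (by simpa using hfz)
      (by simpa using hfz.lt_of_le (not_lt.1 hpos))
    simpa [laplacian_neg] using congrArg (-·) (hl y hy)
  have hle (y : V) : f y ≤ f z / Γ.exitFunction A z * Γ.exitFunction A y := by
    by_cases hy : y ∈ A
    · rw [← abs_of_pos hpos]
      exact (le_abs_self _).trans ((div_le_iff₀ (hh hy)).1 (hmax y hy))
    · simp [hf y hy, exitFunction_mem_dirichletSpace y hy]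
  have ht := le_neg_laplacian_of_forall_le_mul_exitFunction hf hle hz
    (div_mul_cancel₀ _ (hh hz).ne').symm
  rw [hl z hz, div_le_iff₀ (hh hz), mul_right_comm] at ht
  exact (le_mul_iff_one_le_left hpos).1 ht

lemma inv_bottomEigenvalue_le_iSup_meanExitFrom (hA : A.Nonempty) :
    (ENNReal.ofReal (Γ.bottomEigenvalue A))⁻¹ ≤ ⨆ z ∈ A, Γ.meanExitFrom z A := by
  obtain ⟨z, hz, hle⟩ :=
    exists_one_le_mul_exitFunction (bottomEigenvalue_mem_dirichletEigenvalues (Γ := Γ) hA)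
  refine le_iSup₂_of_le z hz ((ENNReal.inv_le_iff_le_mul
    (fun h => absurd h (meanExitFrom_ne_top z)) fun h => absurd h ENNReal.ofReal_ne_top).2 ?_)
  rw [← ofReal_exitFunction, ← ENNReal.ofReal_mul' (exitFunction_nonneg z)]
  exact ENNReal.one_le_ofReal.2 hle

lemma innerProduct_neg_laplacian_exitFunction_inf_one_le {a : ℝ} (ha : 0 < a) :
    ENNReal.ofReal (Γ.innerProduct (-Γ.laplacian (a⁻¹ • Γ.exitFunction A ⊓ 1))
      (a⁻¹ • Γ.exitFunction A ⊓ 1)) ≤ (ENNReal.ofReal a)⁻¹ * Γ.setMeasure A := by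
  cases nonempty_fintype A
  have hu : a⁻¹ • Γ.exitFunction A ∈ dirichletSpace A :=
    Submodule.smul_mem _ _ exitFunction_mem_dirichletSpace
  have hm : a⁻¹ • Γ.exitFunction A ⊓ 1 ∈ dirichletSpace A := fun x hx => by simp [hu x hx]
  have hΔ (x : A) : (-Γ.laplacian (a⁻¹ • Γ.exitFunction A)) x = a⁻¹ := by
    rw [laplacian_smul, ← smul_neg, Pi.smul_apply, Pi.neg_apply, neg_laplacian_exitFunction x.2,
      smul_eq_mul, mul_one]
  rw [setMeasure_eq_ofReal_sum, ← ENNReal.ofReal_inv_of_pos ha,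
    ← ENNReal.ofReal_mul (inv_nonneg.2 ha.le), Finset.mul_sum]
  refine ENNReal.ofReal_le_ofReal ((innerProduct_neg_laplacian_inf_one_le hu).trans ?_)
  rw [innerProduct_eq_sum _ hm]
  refine Finset.sum_le_sum fun x _ => mul_le_mul_of_nonneg_right ?_ (vertexMeasure_nonneg _)
  rw [hΔ]
  exact mul_le_of_le_one_right (inv_nonneg.2 ha.le) inf_le_right

lemma le_resistance_mul_setMeasure (hB : B.Nonempty) {a : ℝ≥0∞}
    (ha : ∀ z ∈ B, a ≤ Γ.meanExitFrom z A) : a ≤ Γ.resistance B Aᶜ * Γ.setMeasure A := by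
  obtain ⟨z, hz⟩ := hB
  lift a to ℝ≥0 using ne_top_of_le_ne_top (meanExitFrom_ne_top z) (ha z hz)
  rcases eq_or_ne a 0 with rfl | ha0
  · exact zero_le
  have hapos : 0 < (a : ℝ) := by positivity
  have hzA : z ∈ A := by
    by_contra hzA
    simpa [meanExitFrom_of_notMem hzA, ha0] using ha z hz
  have hA0 : Γ.setMeasure A ≠ 0 := setMeasure_ne_zero hzA
  set f := (a : ℝ)⁻¹ • Γ.exitFunction A ⊓ 1
  have hfB (x : V) (hx : x ∈ B) : f x = 1 := by
    have hax : (a : ℝ) ≤ Γ.exitFunction A x :=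
      ENNReal.toReal_mono (meanExitFrom_ne_top x) (ha x hx)
    refine inf_eq_right.2 ?_
    rwa [Pi.smul_apply, smul_eq_mul, Pi.one_apply, inv_mul_eq_div, one_le_div hapos]
  have hfA (x : V) (hx : x ∉ A) : f x = 0 := by
    simp [f, exitFunction_mem_dirichletSpace x hx]
  have hsupp : f.support ⊆ A := fun x hx => by
    by_contra hxA
    exact hx (hfA x hxA)
  have hcap : (Γ.resistance B Aᶜ)⁻¹ ≤ (a : ℝ≥0∞)⁻¹ * Γ.setMeasure A := by
    rw [resistance, inv_inv]
    refine (iInf₂_le f ⟨A.toFinite.subset hsupp, hfB, hfA⟩).trans ?_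
    exact (innerProduct_neg_laplacian_exitFunction_inf_one_le hapos).trans_eq
      (by rw [ENNReal.ofReal_coe_nnreal])
  calc (a : ℝ≥0∞) = ((a : ℝ≥0∞)⁻¹ * Γ.setMeasure A)⁻¹ * Γ.setMeasure A := by
        rw [ENNReal.mul_inv (.inr setMeasure_ne_top) (.inr hA0), inv_inv, mul_assoc,
          ENNReal.inv_mul_cancel hA0 setMeasure_ne_top, mul_one]
    _ ≤ Γ.resistance B Aᶜ * Γ.setMeasure A := by
        gcongr
        exact ENNReal.inv_le_iff_inv_le.1 hcap

end

noncomputable section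

variable {V : Type*} {Γ : WeightedGraph V} {D : ℝ≥0}

/-! ### Balls and volumes -/

lemma mem_ball_self (x : V) {R : ℝ} (hR : 0 < R) : x ∈ Γ.ball x R := by
  simpa [ball] using hR

lemma mem_ball_comm {x y : V} {R : ℝ} : y ∈ Γ.ball x R ↔ x ∈ Γ.ball y R := by
  simp only [ball, SimpleGraph.dist_comm, Set.mem_ofPred_eq]

lemma ball_subset_ball {x y : V} {r R : ℝ} (h : Γ.graph.dist x y + r ≤ R) :
    Γ.ball y r ⊆ Γ.ball x R := fun z (hz : (Γ.graph.dist y z : ℝ) < r) => by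
  have htri : (Γ.graph.dist x z : ℝ) ≤ Γ.graph.dist x y + Γ.graph.dist y z := by
    exact_mod_cast Γ.connected.dist_triangle
  exact htri.trans_lt (by linarith)

lemma ball_mono {x : V} {r R : ℝ} (h : r ≤ R) : Γ.ball x r ⊆ Γ.ball x R :=
  ball_subset_ball (by simpa using h)

lemma ball_subset_ball_two_mul {x y : V} {R : ℝ} (hy : y ∈ Γ.ball x R) :
    Γ.ball y R ⊆ Γ.ball x (2 * R) :=
  ball_subset_ball (by have : (Γ.graph.dist x y : ℝ) < R := hy; linarith)

lemma ball_one (x : V) : Γ.ball x 1 = {x} := by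
  ext y
  simp [ball, Γ.connected.dist_eq_zero_iff, eq_comm]

lemma setMeasure_mono {A B : Set V} (h : A ⊆ B) : Γ.setMeasure A ≤ Γ.setMeasure B :=
  ENNReal.tsum_mono_subtype (fun y => ENNReal.ofReal (Γ.vertexMeasure y)) h

lemma setMeasure_diff_add {A B : Set V} (h : B ⊆ A) :
    Γ.setMeasure (A \ B) + Γ.setMeasure B = Γ.setMeasure A := by
  conv_rhs => rw [← Set.sdiff_union_of_subset h]
  exact (ENNReal.summable.tsum_union_disjoint (f := fun y => ENNReal.ofReal (Γ.vertexMeasure y))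
    Set.disjoint_sdiff_left ENNReal.summable).symm

lemma volume_one (x : V) : Γ.volume x 1 = ENNReal.ofReal (Γ.vertexMeasure x) := by
  rw [volume, ball_one]
  exact tsum_singleton x fun y => ENNReal.ofReal (Γ.vertexMeasure y)

lemma volume_two_pow_mul_le (hD : ∀ x R, 0 < R → Γ.volume x (2 * R) ≤ D * Γ.volume x R) (k : ℕ)
    (x : V) {r : ℝ} (hr : 0 < r) : Γ.volume x (2 ^ k * r) ≤ D ^ k * Γ.volume x r := by
  induction k with
  | zero => simp
  | succ k ih =>
    calc Γ.volume x (2 ^ (k + 1) * r) = Γ.volume x (2 * (2 ^ k * r)) := by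
          rw [pow_succ', mul_assoc]
      _ ≤ D * (D ^ k * Γ.volume x r) := (hD x _ (by positivity)).trans (by gcongr)
      _ = D ^ (k + 1) * Γ.volume x r := by rw [pow_succ', mul_assoc]

/-- Every vertex `y` of `B(x,r)` with `r = 2 ^ k` satisfies `μ(x) ≤ V(y,r) ≤ D ^ k μ(y)`, and the
finite volume `V(x,r)` leaves room for finitely many such vertices only. -/
lemma finite_ball [Infinite V] (hD : ∀ x R, 0 < R → Γ.volume x (2 * R) ≤ D * Γ.volume x R)
    (x : V) (R : ℝ) : (Γ.ball x R).Finite := by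
  obtain ⟨k, hk⟩ := pow_unbounded_of_one_lt R one_lt_two
  have hvol (y : V) : Γ.volume y (2 ^ k) ≤ D ^ k * ENNReal.ofReal (Γ.vertexMeasure y) := by
    simpa [volume_one] using volume_two_pow_mul_le hD k y one_pos
  have hlow (y : Γ.ball x (2 ^ k)) :
      ENNReal.ofReal (Γ.vertexMeasure x) / D ^ k ≤ ENNReal.ofReal (Γ.vertexMeasure y) := by
    refine ENNReal.div_le_of_le_mul' (le_trans ?_ (hvol y))
    rw [← volume_one]
    exact setMeasure_mono (ball_one x ▸ Set.singleton_subset_iff.2 (mem_ball_comm.1 y.2))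
  have hfin := ENNReal.finite_const_le_of_tsum_ne_top
    (a := fun y : Γ.ball x (2 ^ k) => ENNReal.ofReal (Γ.vertexMeasure y))
    (ne_top_of_le_ne_top (by finiteness) (hvol x))
    (ε := ENNReal.ofReal (Γ.vertexMeasure x) / D ^ k)
    (ENNReal.div_pos (ENNReal.ofReal_pos.2 (Γ.vertexMeasure_pos x)).ne' (by finiteness)).ne'
  have : Finite (Γ.ball x (2 ^ k)) :=
    Set.finite_univ_iff.1 (hfin.subset fun y _ => hlow y)
  exact (Γ.ball x (2 ^ k)).toFinite.subset (ball_mono hk.le)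

lemma countable_of_finite_ball (hfin : ∀ x R, (Γ.ball x R).Finite) : Countable V := by
  cases isEmpty_or_nonempty V
  · infer_instance
  obtain ⟨x⟩ := ‹Nonempty V›
  refine Set.countable_univ_iff.1
    ((Set.countable_iUnion fun n : ℕ => (hfin x n).countable).mono fun y _ => ?_)
  exact Set.mem_iUnion.2 ⟨Γ.graph.dist x y + 1, by simp [ball]⟩

lemma exists_dist_eq_of_le {x z : V} {n : ℕ} (hn : n ≤ Γ.graph.dist x z) :
    ∃ y, Γ.graph.dist x y = n := by
  obtain ⟨p, hp⟩ := Γ.connected.exists_walk_length_eq_dist x z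
  refine ⟨p.getVert n, ?_⟩
  rw [← SimpleGraph.length_eq_dist_of_subwalk hp (p.isSubwalk_take n),
    SimpleGraph.Walk.take_length, hp, min_eq_left hn]

lemma exists_dist_eq [Infinite V] (hfin : ∀ x R, (Γ.ball x R).Finite) (x : V) (n : ℕ) :
    ∃ y, Γ.graph.dist x y = n := by
  obtain ⟨z, hz⟩ := (hfin x n).exists_notMem
  exact exists_dist_eq_of_le (z := z) (by simpa [ball] using hz)

lemma natCeil_add_two_mul_natFloor_lt {R : ℝ} (hR : 1 / 2 < R) :
    (⌈R⌉₊ + 2 * ⌊R / 4⌋₊ : ℝ) < 2 * R := by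
  rcases le_or_gt 2 R with h2 | h2
  · have hceil := Nat.ceil_lt_add_one (show 0 ≤ R by linarith)
    have hfloor := Nat.floor_le (show 0 ≤ R / 4 by linarith)
    linarith
  · have hfloor : ⌊R / 4⌋₊ = 0 := Nat.floor_eq_zero.2 (by linarith)
    rw [hfloor, Nat.cast_zero, mul_zero, add_zero]
    rcases le_or_gt R 1 with h1 | h1
    · have hceil : (⌈R⌉₊ : ℝ) ≤ 1 := by exact_mod_cast Nat.ceil_le.2 (by simpa using h1)
      linarith
    · have hceil : (⌈R⌉₊ : ℝ) ≤ 2 := by exact_mod_cast Nat.ceil_le.2 (by simpa using h2.le)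
      linarith

lemma exists_ball_subset_annulus [Infinite V] (hfin : ∀ x R, (Γ.ball x R).Finite) (x : V) {R : ℝ}
    (hR : 1 / 2 < R) : ∃ y, Γ.ball y (R / 4) ⊆ Γ.ball x (2 * R) \ Γ.ball x R := by
  obtain ⟨y, hy⟩ := exists_dist_eq hfin x (⌈R⌉₊ + ⌊R / 4⌋₊)
  refine ⟨y, fun z (hz : (Γ.graph.dist y z : ℝ) < R / 4) => ?_⟩
  have hyz : Γ.graph.dist y z ≤ ⌊R / 4⌋₊ := Nat.le_floor hz.le
  have hxz : Γ.graph.dist x z ≤ Γ.graph.dist x y + Γ.graph.dist y z := Γ.connected.dist_triangle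
  have hxy : Γ.graph.dist x y ≤ Γ.graph.dist x z + Γ.graph.dist y z := by
    rw [Γ.graph.dist_comm (u := y)]
    exact Γ.connected.dist_triangle
  constructor
  · have hle : Γ.graph.dist x z ≤ ⌈R⌉₊ + 2 * ⌊R / 4⌋₊ := by omega
    exact lt_of_le_of_lt (by exact_mod_cast hle) (natCeil_add_two_mul_natFloor_lt hR)
  · have hge : ⌈R⌉₊ ≤ Γ.graph.dist x z := by omega
    exact not_lt.2 (Nat.ceil_le.1 hge)

lemma volume_two_mul_le_mul_annulusVolume [Infinite V]
    (hD : ∀ x R, 0 < R → Γ.volume x (2 * R) ≤ D * Γ.volume x R) (x : V) {R : ℝ}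
    (hR : 1 / 2 < R) : Γ.volume x (2 * R) ≤ D ^ 4 * Γ.annulusVolume x R (2 * R) := by
  obtain ⟨y, hy⟩ := exists_ball_subset_annulus (finite_ball hD) x hR
  have hyx : x ∈ Γ.ball y (2 * R) := mem_ball_comm.1 (hy (mem_ball_self y (by linarith))).1
  have : Finite (Γ.ball x R) := finite_ball hD x R
  calc Γ.volume x (2 * R) ≤ Γ.volume y (2 * (2 * R)) :=
        setMeasure_mono (ball_subset_ball_two_mul hyx)
    _ = Γ.volume y (2 ^ 4 * (R / 4)) := by ring_nf
    _ ≤ D ^ 4 * Γ.volume y (R / 4) := volume_two_pow_mul_le hD 4 y (by linarith)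
    _ ≤ D ^ 4 * Γ.annulusVolume x R (2 * R) := by
        gcongr
        refine ENNReal.le_sub_of_add_le_right setMeasure_ne_top ?_
        exact (add_le_add_left (setMeasure_mono hy) _).trans_eq
          (setMeasure_diff_add (ball_mono (by linarith)))

lemma ComparableWith.of_le {C : ℝ≥0} {k₁ k₂ a b : ℝ≥0∞} (hC : C ≠ 0) (h₁ : a ≤ k₁ * b)
    (h₂ : b ≤ k₂ * a) (hk₁ : k₁ ≤ C) (hk₂ : k₂ ≤ C) : ComparableWith C a b := by
  refine ⟨?_, h₂.trans (by gcongr)⟩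
  rw [ENNReal.inv_mul_le_iff (by exact_mod_cast hC) ENNReal.coe_ne_top]
  exact h₁.trans (by gcongr)

/-! ### Eigenvalue, resistance and mean exit time of a ball -/

variable [Infinite V]

lemma annulusResistance_mul_volume_two_mul_le
    (hD : ∀ x R, 0 < R → Γ.volume x (2 * R) ≤ D * Γ.volume x R) (x : V) {R : ℝ} (hR : 0 < R) :
    Γ.annulusResistance x R (2 * R) * Γ.volume x (2 * R) ≤
      D * Γ.invBottomEigenvalue x (2 * R) := by
  have : Finite (Γ.ball x (2 * R)) := finite_ball hD x _
  calc Γ.annulusResistance x R (2 * R) * Γ.volume x (2 * R)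
      ≤ Γ.annulusResistance x R (2 * R) * (D * Γ.volume x R) := by gcongr; exact hD x R hR
    _ = D * (Γ.annulusResistance x R (2 * R) * Γ.volume x R) := mul_left_comm _ _ _
    _ ≤ D * Γ.invBottomEigenvalue x (2 * R) := by
        gcongr
        exact resistance_mul_setMeasure_le_inv_bottomEigenvalue
          ⟨x, mem_ball_self x (by positivity)⟩ (ball_mono (by linarith))

variable [MeasurableSpace V] [DiscreteMeasurableSpace V] {c : ℝ≥0}

lemma meanExit_le_maxMeanExit (x : V) {R : ℝ} (hR : 0 < R) :
    Γ.meanExit x R ≤ Γ.maxMeanExit x R :=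
  le_iSup₂ (f := fun z (_ : z ∈ Γ.ball x R) => Γ.meanExitFrom z (Γ.ball x R)) x
    (mem_ball_self x hR)

lemma maxMeanExit_le_mul_meanExit
    (hc : ∀ x R, 0 < R → ∀ y ∈ Γ.ball x R, Γ.meanExit x (2 * R) ≤ c * Γ.meanExit y R)
    (x : V) {R : ℝ} (hR : 0 < R) : Γ.maxMeanExit x R ≤ c * Γ.meanExit x R :=
  iSup₂_le fun z hz => (meanExitFrom_mono z (ball_subset_ball_two_mul (mem_ball_comm.1 hz))).trans
    (hc z R hR x (mem_ball_comm.1 hz))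

lemma meanExit_le_mul_meanExitFrom
    (hc : ∀ x R, 0 < R → ∀ y ∈ Γ.ball x R, Γ.meanExit x (2 * R) ≤ c * Γ.meanExit y R)
    {x y : V} {R : ℝ} (hR : 0 < R) (hy : y ∈ Γ.ball x R) :
    Γ.meanExit x (2 * R) ≤ c * Γ.meanExitFrom y (Γ.ball x (2 * R)) :=
  (hc x R hR y hy).trans (by gcongr; exact meanExitFrom_mono y (ball_subset_ball_two_mul hy))

variable [Countable V]

lemma invBottomEigenvalue_le_maxMeanExit
    (hD : ∀ x R, 0 < R → Γ.volume x (2 * R) ≤ D * Γ.volume x R) (x : V) {R : ℝ} (hR : 0 < R) :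
    Γ.invBottomEigenvalue x R ≤ Γ.maxMeanExit x R := by
  have : Finite (Γ.ball x R) := finite_ball hD x R
  exact inv_bottomEigenvalue_le_iSup_meanExitFrom ⟨x, mem_ball_self x hR⟩

lemma meanExit_le_mul_annulusResistance_mul_volume
    (hD : ∀ x R, 0 < R → Γ.volume x (2 * R) ≤ D * Γ.volume x R)
    (hc : ∀ x R, 0 < R → ∀ y ∈ Γ.ball x R, Γ.meanExit x (2 * R) ≤ c * Γ.meanExit y R)
    (hc0 : c ≠ 0) (x : V) {R : ℝ} (hR : 0 < R) :
    Γ.meanExit x (2 * R) ≤ c * (Γ.annulusResistance x R (2 * R) * Γ.volume x (2 * R)) := by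
  have : Finite (Γ.ball x (2 * R)) := finite_ball hD x _
  rw [← ENNReal.div_le_iff' (by exact_mod_cast hc0) ENNReal.coe_ne_top]
  exact le_resistance_mul_setMeasure ⟨x, mem_ball_self x hR⟩ fun z hz =>
    ENNReal.div_le_of_le_mul' (meanExit_le_mul_meanExitFrom hc hR hz)

lemma meanExit_le_mul_invBottomEigenvalue
    (hD : ∀ x R, 0 < R → Γ.volume x (2 * R) ≤ D * Γ.volume x R)
    (hc : ∀ x R, 0 < R → ∀ y ∈ Γ.ball x R, Γ.meanExit x (2 * R) ≤ c * Γ.meanExit y R)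
    (hc0 : c ≠ 0) (x : V) {R : ℝ} (hR : 0 < R) :
    Γ.meanExit x (2 * R) ≤ c * D * Γ.invBottomEigenvalue x (2 * R) := by
  refine (meanExit_le_mul_annulusResistance_mul_volume hD hc hc0 x hR).trans ?_
  rw [mul_assoc]
  exact mul_le_mul_right (annulusResistance_mul_volume_two_mul_le hD x hR) _

lemma annulusResistance_mul_annulusVolume_le_mul_maxMeanExit
    (hD : ∀ x R, 0 < R → Γ.volume x (2 * R) ≤ D * Γ.volume x R) (x : V) {R : ℝ} (hR : 0 < R) :
    Γ.annulusResistance x R (2 * R) * Γ.annulusVolume x R (2 * R) ≤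
      D * Γ.maxMeanExit x (2 * R) :=
  calc Γ.annulusResistance x R (2 * R) * Γ.annulusVolume x R (2 * R)
      ≤ Γ.annulusResistance x R (2 * R) * Γ.volume x (2 * R) := mul_le_mul_right tsub_le_self _
    _ ≤ D * Γ.invBottomEigenvalue x (2 * R) := annulusResistance_mul_volume_two_mul_le hD x hR
    _ ≤ D * Γ.maxMeanExit x (2 * R) :=
        mul_le_mul_right (invBottomEigenvalue_le_maxMeanExit hD x (by positivity)) _

lemma meanExit_le_mul_annulusResistance_mul_annulusVolume
    (hD : ∀ x R, 0 < R → Γ.volume x (2 * R) ≤ D * Γ.volume x R)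
    (hc : ∀ x R, 0 < R → ∀ y ∈ Γ.ball x R, Γ.meanExit x (2 * R) ≤ c * Γ.meanExit y R)
    (hc0 : c ≠ 0) (x : V) {R : ℝ} (hR : 1 / 2 < R) :
    Γ.meanExit x (2 * R) ≤
      c * D ^ 4 * (Γ.annulusResistance x R (2 * R) * Γ.annulusVolume x R (2 * R)) :=
  calc Γ.meanExit x (2 * R)
      ≤ c * (Γ.annulusResistance x R (2 * R) * Γ.volume x (2 * R)) :=
        meanExit_le_mul_annulusResistance_mul_volume hD hc hc0 x (by linarith)
    _ ≤ c * (Γ.annulusResistance x R (2 * R) * (D ^ 4 * Γ.annulusVolume x R (2 * R))) := by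
        gcongr
        exact volume_two_mul_le_mul_annulusVolume hD x hR
    _ = c * D ^ 4 * (Γ.annulusResistance x R (2 * R) * Γ.annulusVolume x R (2 * R)) := by ring

end

end WeightedGraph

open WeightedGraph in
theorem mainTheorem1_general {V : Type*} [Infinite V]
    [MeasurableSpace V] [DiscreteMeasurableSpace V] (Γ : WeightedGraph V)
    (hVD : Γ.VolumeDoubling) (hTC : Γ.TimeComparison) :
    ∃ C : ℝ≥0, 1 < C ∧ ∀ (x : V) (R : ℝ), 0 < R →
      WeightedGraph.ComparableWith C (Γ.invBottomEigenvalue x (2 * R)) (Γ.meanExit x (2 * R)) ∧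
      WeightedGraph.ComparableWith C (Γ.meanExit x (2 * R)) (Γ.maxMeanExit x (2 * R)) ∧
      (1 / 2 < R →
        WeightedGraph.ComparableWith C (Γ.maxMeanExit x (2 * R))
          (Γ.annulusResistance x R (2 * R) * Γ.annulusVolume x R (2 * R)) ∧
        WeightedGraph.ComparableWith C (Γ.meanExit x (2 * R))
          (Γ.annulusResistance x R (2 * R) * Γ.annulusVolume x R (2 * R))) := by
  obtain ⟨D, -, hD⟩ := hVD
  obtain ⟨c, hc1, hc⟩ := hTC
  have : Countable V := countable_of_finite_ball (finite_ball hD)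
  have hc0 : c ≠ 0 := (zero_lt_one.trans hc1).ne'
  let C := c + c * D + c * (c * D ^ 4)
  have hC : (C : ℝ≥0∞) = c + c * D + c * (c * D ^ 4) := by push_cast [C]; rfl
  have hc1' : (1 : ℝ≥0∞) ≤ c := by exact_mod_cast hc1.le
  have hcC : (c : ℝ≥0∞) ≤ C := hC ▸ le_add_right le_self_add
  have hcDC : (c * D : ℝ≥0∞) ≤ C := hC ▸ le_add_right le_add_self
  have hccDC : (c * (c * D ^ 4) : ℝ≥0∞) ≤ C := hC ▸ le_add_self
  have hC1 : 1 < C := hc1.trans_le (by exact_mod_cast hcC)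
  have hC0 : C ≠ 0 := (zero_lt_one.trans hC1).ne'
  refine ⟨C, hC1, fun x R hR => ?_⟩
  have h2R : 0 < 2 * R := by positivity
  have hEm := meanExit_le_maxMeanExit (Γ := Γ) x h2R
  have hmE := maxMeanExit_le_mul_meanExit hc x h2R
  have hlE := (invBottomEigenvalue_le_maxMeanExit hD x h2R).trans hmE
  have hEl := meanExit_le_mul_invBottomEigenvalue hD hc hc0 x hR
  refine ⟨.of_le hC0 hlE hEl hcC hcDC,
    .of_le hC0 (by rwa [one_mul]) hmE (hc1'.trans hcC) hcC, fun hR' => ?_⟩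
  have hEv := meanExit_le_mul_annulusResistance_mul_annulusVolume hD hc hc0 x hR'
  have hvm := annulusResistance_mul_annulusVolume_le_mul_maxMeanExit hD x hR
  refine ⟨.of_le hC0 (hmE.trans ((mul_le_mul_right hEv _).trans_eq (mul_assoc _ _ _).symm)) hvm
    hccDC ((le_mul_of_one_le_left' hc1').trans hcDC), .of_le hC0 hEv (hvm.trans ?_)
    ((le_mul_of_one_le_left' hc1').trans hccDC) hcDC⟩
  rw [mul_comm (c : ℝ≥0∞), mul_assoc]
  exact mul_le_mul_right hmE _

theorem mainTheorem1 {V : Type*} [Countable V] [Infinite V]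
    [MeasurableSpace V] [DiscreteMeasurableSpace V] (Γ : WeightedGraph V)
    (hp : Γ.ControlledWeights) (hVD : Γ.VolumeDoubling) (hTC : Γ.TimeComparison) :
    ∃ C : ℝ≥0, 1 < C ∧ ∀ (x : V) (R : ℝ), 0 < R →
      WeightedGraph.ComparableWith C (Γ.invBottomEigenvalue x (2 * R)) (Γ.meanExit x (2 * R)) ∧
      WeightedGraph.ComparableWith C (Γ.meanExit x (2 * R)) (Γ.maxMeanExit x (2 * R)) ∧
      (1 / 2 < R →
        WeightedGraph.ComparableWith C (Γ.maxMeanExit x (2 * R))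
          (Γ.annulusResistance x R (2 * R) * Γ.annulusVolume x R (2 * R)) ∧
        WeightedGraph.ComparableWith C (Γ.meanExit x (2 * R))
          (Γ.annulusResistance x R (2 * R) * Γ.annulusVolume x R (2 * R))) :=
  mainTheorem1_general Γ hVD hTC
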